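/- All graphs are finite and simple. A star edge coloring of a graph $G$ is a proper edge coloring of $G$ in which no path with four edges and no cycle with four edges is colored with exactly two colors; the star chromatic index $\chi'_{st}(G)$ is the minimum number $t$ for which $G$ has a star edge coloring with $t$ colors. For a bipartite graph $G=(X,Y;E)$ with parts $X$ and $Y$, let $\Delta(X)$ and $\Delta(Y)$ denote the maximum degree in $G$ of the vertices in $X$ and in $Y$, respectively. Theorem. Let $k \ge 0$ be an integer. If $G=(X,Y;E)$ is a bipartite graph with $\Delta(X)=2$ and $\Delta(Y)=2k+1$, then $\chi'_{st}(G)\le 3k+2$. This bound is sharp: for every integer $k\ge 0$ there is a bipartite graph $G=(X,Y;E)$ with $\Delta(X)=2$, $\Delta(Y)=2k+1$ and $\chi'_{st}(G)=3k+2$. -/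

import Mathlib

namespace SimpleGraph

/-- The colors that the edge coloring `f` uses on the edges of the walk `p`. -/
def Walk.colorSet {V C : Type*} {G : SimpleGraph V} (f : G.edgeSet → C) {u v : V}
    (p : G.Walk u v) : Set C :=
  f '' {e : G.edgeSet | (e : Sym2 V) ∈ p.edges}

/-- A proper edge coloring of `G` (a proper vertex coloring of its line graph) is a star edge
coloring if no path with four edges and no cycle with four edges is colored with exactly
two colors. -/
def IsStarEdgeColoring {V C : Type*} {G : SimpleGraph V} (f : G.lineGraph.Coloring C) : Prop :=
  (∀ (u v : V) (p : G.Walk u v), p.IsPath → p.length = 4 → (p.colorSet f).encard ≠ 2) ∧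
  (∀ (u : V) (p : G.Walk u u), p.IsCycle → p.length = 4 → (p.colorSet f).encard ≠ 2)

/-- `G` has a star edge coloring with colors taken from a set of `n` colors. -/
def StarEdgeColorable {V : Type*} (G : SimpleGraph V) (n : ℕ) : Prop :=
  ∃ f : G.lineGraph.Coloring (Fin n), IsStarEdgeColoring f

/-- The star chromatic index: the least number of colors in a star edge coloring
(`⊤` if no finite number of colors is enough). -/
noncomputable def starChromaticIndex {V : Type*} (G : SimpleGraph V) : ℕ∞ :=
  ⨅ n ∈ {n : ℕ | G.StarEdgeColorable n}, (n : ℕ∞)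

/-- The maximum degree in `G` of the vertices that belong to `S`. -/
noncomputable def maxDegreeOn {V : Type*} (G : SimpleGraph V) (S : Set V) : ℕ∞ :=
  ⨆ v ∈ S, (G.neighborSet v).encard

/-- `G` is a bipartite graph with parts `X` and `Y`: the parts are disjoint and cover all vertices,
and every edge joins a vertex of `X` to a vertex of `Y`. -/
def HasBipartition {V : Type*} (G : SimpleGraph V) (X Y : Set V) : Prop :=
  G.IsBipartiteWith X Y ∧ X ∪ Y = Set.univ

end SimpleGraph

/-! A bipartite graph whose `X`-degrees are at most 2 is the subdivision of a loopless multigraph on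
`Y`: every `X`-vertex is an edge, every edge of `G` a half-edge. An `X`-vertex of degree 1 becomes
an edge to a dummy vertex. So the task is to color the half-edges of a multigraph of maximum degree
at most `2k+1`.

If the multigraph is `2k`-regular, a balanced orientation and König's theorem split its arcs into
`k` classes, each with one arc into and one arc out of every vertex, that is, a union of directed
cycles. The subdivision of such a union needs only three colors, and distinct classes use disjoint
palettes, so `3k` colors suffice. Maximum degree at most `2k` reduces to this by embedding in a
regular multigraph.

For maximum degree `2k+1`, a minimal edge cover is a spanning star forest. One new color goes to its
half-edges at leaves, another to one half-edge at each star center. This takes one half-edge away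
from every non-isolated vertex, and the rest needs `3k` colors.

The bound is attained by the complete bipartite graph with parts of sizes `2k+1` and 2: the palettes
at its two big vertices share at most `k` colors. -/

open Finset

/-! ### Half-edges and colorings of subdivisions -/

/-- The other half of the edge to which a half-edge belongs. -/
def oppositeHalf {E : Type*} (h : E × Bool) : E × Bool := (h.1, !h.2)

@[simp] theorem oppositeHalf_fst {E : Type*} (h : E × Bool) : (oppositeHalf h).1 = h.1 := rfl

@[simp] theorem oppositeHalf_oppositeHalf {E : Type*} (h : E × Bool) :
    oppositeHalf (oppositeHalf h) = h := by simp [oppositeHalf]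

theorem eq_or_eq_oppositeHalf {E : Type*} {h h' : E × Bool} (H : h.1 = h'.1) :
    h = h' ∨ h = oppositeHalf h' := by
  obtain ⟨e, i⟩ := h
  obtain ⟨e', j⟩ := h'
  obtain rfl : e = e' := H
  cases i <;> cases j <;> simp [oppositeHalf]

/-- A coloring of the half-edges of a multigraph (with edges `E` and vertices `V`, where `ends`
attaches half-edges to vertices) that is a star edge coloring of the graph obtained by
subdividing every edge once. -/
structure IsHalfStarColoring {E V C : Type*} (ends : E × Bool → V) (f : E × Bool → C) : Prop where
  ne_opposite : ∀ h, f h ≠ f (oppositeHalf h)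
  ne_of_ends_eq : ∀ h h', ends h = ends h' → h ≠ h' → f h ≠ f h'
  at_vertex : ∀ h h', ends h = ends h' → h ≠ h' →
    f h = f (oppositeHalf h') → f (oppositeHalf h) ≠ f h'
  at_edge : ∀ h h₁ h₂, ends h₁ = ends h → h₁ ≠ h → ends h₂ = ends (oppositeHalf h) →
    h₂ ≠ oppositeHalf h → f h₁ = f (oppositeHalf h) → f h₂ ≠ f h

/-! ### Splitting a regular multigraph into directed cycles -/

/-- A multigraph all of whose degrees are `2 * k` has an orientation with all in- and
out-degrees equal to `k`. -/
theorem exists_balanced_orientation {E V : Type*} [Fintype E] [Fintype V] [DecidableEq V] (k : ℕ)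
    (ends : E × Bool → V) (hd : ∀ v, #{h | ends h = v} = 2 * k) :
    ∃ o : E → Bool, (∀ v, #{e | ends (e, o e) = v} = k) ∧ ∀ v, #{e | ends (e, !o e) = v} = k := by
  classical
  -- Every vertex offers `k` slots, and an edge may take a slot at either end. A Hall injection
  -- chooses the end that each edge is oriented from.
  let t : E → Finset (V × Fin k) := fun e => {ends (e, false), ends (e, true)} ×ˢ univ
  have hall : ∀ S : Finset E, #S ≤ #(S.biUnion t) := by
    intro S
    let W : Finset V := S.biUnion fun e => {ends (e, false), ends (e, true)}
    have hW : S.biUnion t = W ×ˢ univ := by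
      ext ⟨v, i⟩
      simp [t, W]
    have h1 : #(S ×ˢ (univ : Finset Bool)) ≤ #W * (2 * k) := by
      have : S ×ˢ (univ : Finset Bool) ⊆ W.biUnion fun v => {h | ends h = v} := by
        rintro ⟨e, i⟩ he
        simp only [mem_product, mem_univ, and_true] at he
        simp only [mem_biUnion, mem_filter, mem_univ, true_and, exists_eq_right', W]
        refine ⟨e, he, ?_⟩
        cases i <;> simp
      refine (card_le_card this).trans (card_biUnion_le_card_mul _ _ _ fun v _ => (hd v).le)
    rw [hW, card_product, card_univ, Fintype.card_fin]
    rw [card_product, card_univ, Fintype.card_bool] at h1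
    nlinarith
  obtain ⟨f, hf, hft⟩ := (Finset.all_card_le_biUnion_card_iff_exists_injective t).1 hall
  have hex : ∀ e, ∃ i, ends (e, i) = (f e).1 := by
    intro e
    have := hft e
    simp only [t, mem_product, mem_insert, mem_singleton, mem_univ, and_true] at this
    rcases this with h | h
    · exact ⟨_, h.symm⟩
    · exact ⟨_, h.symm⟩
  choose o ho using hex
  have hle : ∀ v, #{e | ends (e, o e) = v} ≤ k := by
    intro v
    have : #{e | ends (e, o e) = v} ≤ #(univ : Finset (Fin k)) := by
      refine card_le_card_of_injOn (fun e => (f e).2) (fun _ _ => mem_univ _) ?_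
      intro a ha b hb hab
      simp only [coe_filter, mem_univ, true_and, Set.mem_ofPred_eq, ho] at ha hb
      exact hf (Prod.ext (ha.trans hb.symm) hab)
    simpa using this
  have hadd : ∀ v, #{e | ends (e, o e) = v} + #{e | ends (e, !o e) = v} = 2 * k := by
    intro v
    rw [← hd v, ← card_disjSum]
    refine card_nbij' (Sum.elim (fun e => (e, o e)) (fun e => (e, !o e)))
      (fun h => if h.2 = o h.1 then Sum.inl h.1 else Sum.inr h.1) ?_ ?_ ?_ ?_
    · rintro (e | e) he <;> simpa using he
    · rintro ⟨e, i⟩ he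
      simp only [coe_filter, mem_univ, true_and, Set.mem_ofPred_eq] at he
      by_cases h : i = o e
      · subst h; simpa using he
      · obtain rfl : i = !o e := by revert h; cases i <;> cases o e <;> simp
        simpa using he
    · rintro (e | e) he <;> simp
    · rintro ⟨e, i⟩ he
      by_cases h : i = o e
      · simp [h]
      · obtain rfl : i = !o e := by revert h; cases i <;> cases o e <;> simp
        simp
  -- There are exactly `k * |V|` edges, so the bounds `hle` are all equalities.
  have hsum : ∑ v, #{e | ends (e, o e) = v} = ∑ v : V, k := by
    have h1 : ∑ v, #{e | ends (e, o e) = v} = Fintype.card E := by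
      rw [← card_univ, ← card_eq_sum_card_fiberwise (fun _ _ => mem_univ _)]
    have h2 : ∑ v, #{h | ends h = v} = Fintype.card E * 2 := by
      rw [← card_eq_sum_card_fiberwise (fun _ _ => mem_univ _)]
      simp
    simp only [hd, sum_const, smul_eq_mul, card_univ] at h2 ⊢
    rw [h1]
    nlinarith
  have heq := (sum_eq_sum_iff_of_le fun v _ => hle v).1 hsum
  refine ⟨o, fun v => heq v (mem_univ v), fun v => ?_⟩
  have h1 := heq v (mem_univ v)
  have h2 := hadd v
  omega

/-- König's edge coloring theorem for regular bipartite multigraphs, with `p` and `q` giving the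
two endpoints of an edge in `S`. -/
theorem exists_regular_bipartite_edge_coloring {E V : Type*} [Fintype V] [DecidableEq V]
    [DecidableEq E] (p q : E → V) (k : ℕ) : ∀ S : Finset E, (∀ v, #{e ∈ S | p e = v} = k) →
    (∀ v, #{e ∈ S | q e = v} = k) → ∃ c : E → ℕ, (∀ e ∈ S, c e < k) ∧
      ∀ e ∈ S, ∀ e' ∈ S, c e = c e' → (p e = p e' ∨ q e = q e') → e = e' := by
  induction k with
  | zero =>
    intro S hp _
    have : S = ∅ := by
      by_contra h
      obtain ⟨e, he⟩ := nonempty_iff_ne_empty.2 h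
      have := hp (p e)
      rw [card_eq_zero, filter_eq_empty_iff] at this
      exact this he rfl
    subst this
    exact ⟨fun _ => 0, by simp, by simp⟩
  | succ k ih =>
    intro S hp hq
    -- Hall's theorem for the bipartite multigraph gives a perfect matching `M`, which becomes color
    -- class `k`; what remains is `k`-regular.
    let t : V → Finset V := fun v => {e ∈ S | p e = v}.image q
    have hall : ∀ W : Finset V, #W ≤ #(W.biUnion t) := by
      intro W
      have h1 : #{e ∈ S | p e ∈ W} = #W * (k + 1) := by
        rw [card_eq_sum_card_fiberwise (f := p) (t := W) (fun e he => by simp_all)]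
        rw [sum_congr rfl (g := fun _ => k + 1), sum_const, smul_eq_mul]
        intro v hv
        rw [← hp v, filter_filter]
        congr 1
        ext e
        simp only [mem_filter]
        constructor
        · rintro ⟨h, _, h'⟩; exact ⟨h, h'⟩
        · rintro ⟨h, rfl⟩; exact ⟨h, hv, rfl⟩
      have h2 : #{e ∈ S | p e ∈ W} ≤ #(W.biUnion t) * (k + 1) := by
        have : {e ∈ S | p e ∈ W} ⊆ (W.biUnion t).biUnion fun v => {e ∈ S | q e = v} := by
          intro e he
          simp only [mem_filter] at he
          simp only [mem_biUnion, mem_filter]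
          refine ⟨q e, ⟨p e, he.2, ?_⟩, he.1, rfl⟩
          exact mem_image_of_mem _ (by simp [he.1])
        exact (card_le_card this).trans (card_biUnion_le_card_mul _ _ _ fun v _ => (hq v).le)
      rw [h1] at h2
      exact Nat.le_of_mul_le_mul_right h2 (Nat.succ_pos k)
    obtain ⟨f, hf, hft⟩ := (Finset.all_card_le_biUnion_card_iff_exists_injective t).1 hall
    have hex : ∀ v, ∃ e ∈ S, p e = v ∧ q e = f v := by
      intro v
      obtain ⟨e, he, h⟩ := mem_image.1 (hft v)
      rw [mem_filter] at he
      exact ⟨e, he.1, he.2, h⟩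
    choose m hmS hmp hmq using hex
    have hfs : Function.Surjective f := Finite.surjective_of_injective hf
    let M : Finset E := univ.image m
    have hM : ∀ e, e ∈ M ↔ e = m (p e) := by
      intro e
      simp only [M, mem_image, mem_univ, true_and]
      constructor
      · rintro ⟨v, rfl⟩; rw [hmp]
      · intro h; exact ⟨_, h.symm⟩
    have hMp : ∀ v, #{e ∈ S \ M | p e = v} = k := by
      intro v
      have : ({e ∈ S \ M | p e = v} : Finset E) = ({e ∈ S | p e = v} : Finset E).erase (m v) := by
        ext e
        simp only [mem_filter, mem_sdiff, mem_erase, hM]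
        constructor
        · rintro ⟨⟨h1, h2⟩, rfl⟩; exact ⟨h2, h1, rfl⟩
        · rintro ⟨h1, h2, rfl⟩; exact ⟨⟨h2, h1⟩, rfl⟩
      rw [this, card_erase_of_mem (by simp [hmS, hmp]), hp, Nat.add_sub_cancel]
    have hMq : ∀ v, #{e ∈ S \ M | q e = v} = k := by
      intro v
      obtain ⟨u, rfl⟩ := hfs v
      have : ({e ∈ S \ M | q e = f u} : Finset E)
          = ({e ∈ S | q e = f u} : Finset E).erase (m u) := by
        ext e
        simp only [mem_filter, mem_sdiff, mem_erase, hM]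
        constructor
        · rintro ⟨⟨h1, h2⟩, h3⟩
          refine ⟨?_, h1, h3⟩
          rintro rfl
          rw [hmp] at h2
          exact h2 rfl
        · rintro ⟨h1, h2, h3⟩
          refine ⟨⟨h2, fun h => h1 ?_⟩, h3⟩
          rw [h, hmq] at h3
          rw [h, hf h3]
      rw [this, card_erase_of_mem (by simp [hmS, hmq]), hq, Nat.add_sub_cancel]
    obtain ⟨c, hc, hcc⟩ := ih (S \ M) hMp hMq
    refine ⟨fun e => if e ∈ M then k else c e, fun e he => ?_, fun e he e' he' h hpq => ?_⟩
    · by_cases h : e ∈ M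
      · simp [h]
      · simpa [h] using (hc e (by simp [he, h])).trans (Nat.lt_succ_self k)
    · by_cases h1 : e ∈ M <;> by_cases h2 : e' ∈ M
      · rw [hM] at h1 h2
        rcases hpq with hpq | hpq
        · rw [h1, h2, hpq]
        · rw [h1, h2, hmq, hmq] at hpq
          rw [h1, h2, hf hpq]
      · have := hc e' (by simp [he', h2])
        simp only [h1, h2, if_true, if_false] at h
        omega
      · have := hc e (by simp [he, h1])
        simp only [h1, h2, if_true, if_false] at h
        omega
      · simp only [h1, h2, if_false] at h
        exact hcc e (by simp [he, h1]) e' (by simp [he', h2]) h hpq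

/-! ### Three colors for directed paths and cycles -/

/-- The arcs of a disjoint union of directed paths and directed cycles without loops (where `r` is
the relation of following each other) can be assigned pairs `(a e, b e)` of colors out of three
that form a star edge coloring of the graph obtained by subdividing every arc. -/
theorem exists_three_coloring_of_succ {E : Type*} [Finite E] (r : E → E → Prop)
    (hirr : ∀ e, ¬ r e e) (hsucc : ∀ e e₁ e₂, r e e₁ → r e e₂ → e₁ = e₂)
    (hpred : ∀ e e₁ e₂, r e₁ e → r e₂ e → e₁ = e₂) :
    ∃ a b : E → Fin 3, (∀ e, a e ≠ b e) ∧ (∀ e e', r e e' → b e ≠ a e') ∧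
      (∀ e e', r e e' → a e = a e' → b e ≠ b e') ∧
      (∀ e₀ e e₁, r e₀ e → r e e₁ → b e₀ = b e → a e ≠ a e₁) := by
  classical
  -- Between consecutive members of a maximal independent set `B` of arcs lie only one or two other
  -- arcs.
  obtain ⟨B, hB⟩ := (Set.toFinite {B : Set E | ∀ x ∈ B, ∀ y ∈ B, ¬ r x y}).exists_maximal
    ⟨∅, by simp⟩
  have hind : ∀ x ∈ B, ∀ y ∈ B, ¬ r x y := hB.prop
  have hmax : ∀ e, e ∉ B → ∃ x ∈ B, r x e ∨ r e x := by
    intro e he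
    by_contra! hcon
    refine he (hB.le_of_ge (y := insert e B) ?_ (Set.subset_insert e B) (Set.mem_insert e B))
    intro x hx y hy
    rcases hx with rfl | hx <;> rcases hy with rfl | hy
    · exact hirr _
    · exact (hcon y hy).2
    · exact (hcon x hx).1
    · exact hind x hx y hy
  let P : E → Prop := fun e => ∃ x ∈ B, r x e
  let Q : E → Prop := fun e => ∃ x ∈ B, r e x
  -- Label 0 marks `B`, 1 a gap of one arc, and 2, 3 a gap of two; the first arc of a path, if
  -- outside `B`, also gets 3.
  let l : E → Fin 4 := fun e => if e ∈ B then 0 else if P e then if Q e then 1 else 2 else 3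
  -- Block `0 1` is colored 01 02 and block `0 2 3` is colored 01 20 12; these blocks can be
  -- concatenated in any order.
  let A : Fin 4 → Fin 3 := ![0, 0, 2, 1]
  let A' : Fin 4 → Fin 3 := ![1, 2, 0, 2]
  have step : ∀ e e', r e e' → (l e = 0 ∧ l e' = 1) ∨ (l e = 0 ∧ l e' = 2) ∨
      (l e = 1 ∧ l e' = 0) ∨ (l e = 2 ∧ l e' = 3) ∨ (l e = 3 ∧ l e' = 0) := by
    intro e e' h
    by_cases heB : e ∈ B
    · have h1 : e' ∉ B := fun h' => hind e heB e' h' h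
      have h2 : P e' := ⟨e, heB, h⟩
      by_cases h3 : Q e' <;> simp [l, heB, h1, h2, h3]
    · by_cases h1 : Q e
      · have h2 : e' ∈ B := by
          obtain ⟨x, hx, hx'⟩ := h1
          rwa [hsucc e e' x h hx']
        by_cases h3 : P e <;> simp [l, heB, h1, h2, h3]
      · have h2 : e' ∉ B := fun h' => h1 ⟨e', h', h⟩
        have h3 : P e := by
          obtain ⟨x, hx, hx' | hx'⟩ := hmax e heB
          · exact ⟨x, hx, hx'⟩
          · exact absurd ⟨x, hx, hx'⟩ h1
        have h4 : ¬ P e' := by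
          rintro ⟨x, hx, hx'⟩
          rw [hpred e' x e hx' h] at hx
          exact heB hx
        simp [l, heB, h1, h2, h3, h4]
  refine ⟨fun e => A (l e), fun e => A' (l e), fun e => ?_, fun e e' h => ?_, fun e e' h => ?_,
    fun e₀ e e₁ h₀ h₁ => ?_⟩
  · have : ∀ x, A x ≠ A' x := by decide
    exact this _
  · rcases step e e' h with h | h | h | h | h <;> simp [h.1, h.2, A, A']
  · rcases step e e' h with h | h | h | h | h <;> simp [h.1, h.2, A, A']
  · rcases step _ _ h₀ with h | h | h | h | h <;> rcases step _ _ h₁ with h' | h' | h' | h' | h' <;>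
      simp [h.1, h'.1, h'.2, A, A'] <;> simp_all

/-! ### Even maximum degree -/

/-- The subdivision of a loopless `2 * k`-regular multigraph has a star edge coloring with
`3 * k` colors. -/
theorem exists_isHalfStarColoring_of_regular {E V : Type*} [Fintype E] [Fintype V] [DecidableEq V]
    (k : ℕ) (ends : E × Bool → V) (hloop : ∀ h, ends h ≠ ends (oppositeHalf h))
    (hd : ∀ v, #{h | ends h = v} = 2 * k) :
    ∃ f : E × Bool → Fin k × Fin 3, IsHalfStarColoring ends f := by
  classical
  obtain ⟨o, ho1, ho2⟩ := exists_balanced_orientation k ends hd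
  obtain ⟨c, hc, hcc⟩ := exists_regular_bipartite_edge_coloring (fun e => ends (e, o e))
    (fun e => ends (e, !o e)) k univ ho1 ho2
  simp only [mem_univ, true_implies] at hc hcc
  obtain ⟨a, b, hab, hr, hv, he⟩ := exists_three_coloring_of_succ
    (fun e e' => c e = c e' ∧ ends (e, !o e) = ends (e', o e'))
    (fun e h => hloop (e, o e) h.2.symm)
    (fun e e₁ e₂ h h' => hcc _ _ (h.1.symm.trans h'.1) (Or.inl (h.2.symm.trans h'.2)))
    (fun e e₁ e₂ h h' => hcc _ _ (h.1.trans h'.1.symm) (Or.inr (h.2.trans h'.2.symm)))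
  let g : E × Bool → Fin 3 := fun h => if h.2 = o h.1 then a h.1 else b h.1
  have hcases : ∀ h : E × Bool, h = (h.1, o h.1) ∨ h = (h.1, !o h.1) := by
    rintro ⟨e, i⟩
    cases i <;> cases o e <;> simp
  have hga : ∀ e, g (e, o e) = a e := by simp [g]
  have hgb : ∀ e, g (e, !o e) = b e := by simp [g]
  -- two half-edges of the same class at a vertex belong to consecutive arcs
  have key : ∀ h h' : E × Bool, ends h = ends h' → h ≠ h' → c h.1 = c h'.1 →
      (h = (h.1, o h.1) ∧ h' = (h'.1, !o h'.1) ∧ c h'.1 = c h.1 ∧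
        ends (h'.1, !o h'.1) = ends (h.1, o h.1)) ∨
      (h = (h.1, !o h.1) ∧ h' = (h'.1, o h'.1) ∧ c h.1 = c h'.1 ∧
        ends (h.1, !o h.1) = ends (h'.1, o h'.1)) := by
    intro h h' hv hne hch
    rcases hcases h with h1 | h1 <;> rcases hcases h' with h2 | h2
    · rw [h1, h2] at hv
      have := hcc _ _ hch (Or.inl hv)
      exact absurd (by rw [h1, h2, this]) hne
    · refine Or.inl ⟨h1, h2, hch.symm, ?_⟩
      rw [← h1, ← h2, hv]
    · refine Or.inr ⟨h1, h2, hch, ?_⟩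
      rw [← h1, ← h2, hv]
    · rw [h1, h2] at hv
      have := hcc _ _ hch (Or.inr hv)
      exact absurd (by rw [h1, h2, this]) hne
  have hopp : ∀ e, oppositeHalf (e, o e) = (e, !o e) := fun e => rfl
  have hopp' : ∀ e, oppositeHalf (e, !o e) = (e, o e) := fun e => by simp [oppositeHalf]
  refine ⟨fun h => (⟨c h.1, hc h.1⟩, g h), ⟨?_, ?_, ?_, ?_⟩⟩
  · intro h heq
    simp only [Prod.mk.injEq, oppositeHalf_fst, true_and] at heq
    rcases hcases h with h1 | h1 <;> rw [h1] at heq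
    · rw [hopp, hga, hgb] at heq; exact hab _ heq
    · rw [hopp', hga, hgb] at heq; exact hab _ heq.symm
  · intro h h' hvv hne heq
    simp only [Prod.mk.injEq, Fin.mk.injEq] at heq
    rcases key h h' hvv hne heq.1 with ⟨h1, h2, h3⟩ | ⟨h1, h2, h3⟩
    · rw [h1, h2, hga, hgb] at heq
      exact hr _ _ h3 heq.2.symm
    · rw [h1, h2, hga, hgb] at heq
      exact hr _ _ h3 heq.2
  · intro h h' hvv hne heq heq'
    simp only [Prod.mk.injEq, Fin.mk.injEq, oppositeHalf_fst] at heq heq'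
    rcases key h h' hvv hne heq.1 with ⟨h1, h2, h3⟩ | ⟨h1, h2, h3⟩
    · rw [h1, h2, hopp', hga, hga] at heq
      rw [h1, h2, hopp, hgb, hgb] at heq'
      exact hv _ _ h3 heq.2.symm heq'.2.symm
    · rw [h1, h2, hopp, hgb, hgb] at heq
      rw [h1, h2, hopp', hga, hga] at heq'
      exact hv _ _ h3 heq'.2 heq.2
  · intro h h₁ h₂ hv1 hne1 hv2 hne2 heq1 heq2
    simp only [Prod.mk.injEq, Fin.mk.injEq, oppositeHalf_fst] at heq1 heq2
    rcases key h₁ h hv1 hne1 heq1.1 with ⟨h1, h2, h3⟩ | ⟨h1, h2, h3⟩ <;>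
      rcases key h₂ _ hv2 hne2 heq2.1 with ⟨h4, h5, h6⟩ | ⟨h4, h5, h6⟩
    · rw [h2] at h5
      simp [hopp'] at h5
    · rw [h1, h2, hopp', hga, hga] at heq1
      rw [h2, h4, hgb, hgb] at heq2
      exact he _ _ _ h6 h3 heq2.2 heq1.2.symm
    · rw [h1, h2, hopp, hgb, hgb] at heq1
      rw [h2, h4, hga, hga] at heq2
      exact he _ _ _ h3 h6 heq1.2 heq2.2.symm
    · rw [h2] at h5
      simp [hopp] at h5

/-- The subdivision of a loopless multigraph with maximum degree at most `2 * k` has a star edge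
coloring with `3 * k` colors. -/
theorem exists_isHalfStarColoring_of_degree_le {E V : Type*} [Fintype E] [Fintype V]
    [DecidableEq V] (k : ℕ) (ends : E × Bool → V) (hloop : ∀ h, ends h ≠ ends (oppositeHalf h))
    (hd : ∀ v, #{h | ends h = v} ≤ 2 * k) :
    ∃ f : E × Bool → Fin k × Fin 3, IsHalfStarColoring ends f := by
  classical
  -- Two copies of the multigraph, with the copies of `v` joined by `d v` parallel edges, form a
  -- loopless `2k`-regular multigraph.
  let d : V → ℕ := fun v => 2 * k - #{h | ends h = v}
  let ends' : ((E × Bool) ⊕ (Σ v, Fin (d v))) × Bool → V × Bool := fun h =>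
    Sum.elim (fun x : E × Bool => (ends (x.1, h.2), x.2)) (fun x => (x.1, h.2)) h.1
  have hl' : ∀ h, ends' h ≠ ends' (oppositeHalf h) := by
    rintro ⟨⟨e, b⟩ | ⟨v, j⟩, i⟩ h
    · exact hloop (e, i) (congrArg Prod.fst h)
    · simp [ends', oppositeHalf] at h
  have hd' : ∀ v, #{h | ends' h = v} = 2 * k := by
    rintro ⟨v, b⟩
    have h1 : 2 * k = #{h | ends h = v} + #(univ : Finset (Fin (d v))) := by
      have := hd v
      simp only [card_univ, Fintype.card_fin, d]
      omega
    rw [h1, ← card_disjSum]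
    symm
    refine card_bij (fun x _ => Sum.elim (fun h : E × Bool => (Sum.inl (h.1, b), h.2))
      (fun j => (Sum.inr ⟨v, j⟩, b)) x) ?_ ?_ ?_
    · rintro (⟨e, i⟩ | j) hx
      · simpa [ends'] using hx
      · simp [ends']
    · rintro (⟨e, i⟩ | j) hx (⟨e', i'⟩ | j') hx' h <;> simp_all
    · rintro ⟨⟨e, b'⟩ | ⟨v', j⟩, i⟩ hx
      · simp only [mem_filter, mem_univ, true_and, ends', Sum.elim_inl, Prod.mk.injEq] at hx
        obtain ⟨h1, rfl⟩ := hx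
        exact ⟨Sum.inl (e, i), by simpa using h1, rfl⟩
      · simp only [mem_filter, mem_univ, true_and, ends', Sum.elim_inr, Prod.mk.injEq] at hx
        obtain ⟨rfl, rfl⟩ := hx
        exact ⟨Sum.inr j, by simp, rfl⟩
  obtain ⟨f, hf⟩ := exists_isHalfStarColoring_of_regular k ends' hl' hd'
  let ι : E × Bool → ((E × Bool) ⊕ (Σ v, Fin (d v))) × Bool := fun h => (Sum.inl (h.1, false), h.2)
  have hι : ∀ h h', ends h = ends h' → ends' (ι h) = ends' (ι h') := by
    intro h h' H
    simp [ι, ends', H]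
  have hinj : ∀ h h', h ≠ h' → ι h ≠ ι h' := by
    intro h h' H H'
    simp only [ι, Prod.mk.injEq, Sum.inl.injEq, and_true] at H'
    exact H (Prod.ext H'.1 H'.2)
  refine ⟨fun h => f (ι h), ⟨fun h => hf.ne_opposite (ι h), fun h h' H H' =>
    hf.ne_of_ends_eq _ _ (hι _ _ H) (hinj _ _ H'), fun h h' H H' =>
    hf.at_vertex _ _ (hι _ _ H) (hinj _ _ H'), fun h h₁ h₂ H H' H'' H''' =>
    hf.at_edge _ _ _ (hι _ _ H) (hinj _ _ H') (hι _ _ H'') (hinj _ _ H''')⟩⟩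

/-! ### Odd maximum degree -/

/-- A spanning star forest `F`, described through the predicates `L` (half-edges at the leaves of
its stars) and `S` (one half-edge at the center of every star). -/
theorem exists_spanning_star_forest {E V : Type*} [Finite E] (ends : E × Bool → V)
    (hloop : ∀ h, ends h ≠ ends (oppositeHalf h)) :
    ∃ (F : Set E) (L S : E × Bool → Prop),
      (∀ h, ∃ h', ends h' = ends h ∧ (L h' ∨ S h')) ∧
      (∀ h, L h → h.1 ∈ F) ∧ (∀ h, S h → h.1 ∈ F) ∧
      (∀ h h', L h → h'.1 ∈ F → ends h' = ends h → h' = h) ∧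
      (∀ h h', S h → S h' → ends h' = ends h → h' = h) ∧
      (∀ h, S h → L (oppositeHalf h)) ∧ (∀ h, L h → ¬ L (oppositeHalf h)) := by
  classical
  obtain ⟨F, hF⟩ := (Set.toFinite {F : Set E | ∀ h, ∃ h', h'.1 ∈ F ∧ ends h' = ends h}).exists_minimal
    ⟨Set.univ, fun h => ⟨h, Set.mem_univ _, rfl⟩⟩
  have hcov : ∀ h, ∃ h', h'.1 ∈ F ∧ ends h' = ends h := hF.prop
  -- By minimality, each edge of the cover has an end that no other edge of `F` meets; this end is
  -- its leaf.
  have hpriv : ∀ e ∈ F, ∃ i, ∀ h, h.1 ∈ F → ends h = ends (e, i) → h.1 = e := by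
    intro e he
    by_contra! hcon
    have : e ∈ F \ {e} := by
      refine hF.le_of_le (y := F \ {e}) (fun h => ?_) Set.sdiff_subset he
      obtain ⟨⟨e', i⟩, h1, h2⟩ := hcov h
      by_cases hee : e' = e
      · subst hee
        obtain ⟨h', h3, h4, h5⟩ := hcon i
        exact ⟨h', ⟨h3, h5⟩, h4.trans h2⟩
      · exact ⟨(e', i), ⟨h1, hee⟩, h2⟩
    exact this.2 rfl
  choose! leaf hleaf using hpriv
  -- One half-edge of `F` is selected at each covered vertex. At a leaf it is the leaf half-edge;
  -- elsewhere it is the one for `S`.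
  let spec : V → Option (E × Bool) := fun v =>
    if H : ∃ h : E × Bool, h.1 ∈ F ∧ ends h = v then some H.choose else none
  let L : E × Bool → Prop := fun h => h.1 ∈ F ∧ h.2 = leaf h.1
  refine ⟨F, L, fun h => h.1 ∈ F ∧ ¬ L h ∧ spec (ends h) = some h, fun h => ?_, fun h H => H.1,
    fun h H => H.1, ?_, ?_, ?_, ?_⟩
  · have H := hcov h
    have h1 : spec (ends h) = some H.choose := dif_pos H
    obtain ⟨h2, h3⟩ := H.choose_spec
    refine ⟨H.choose, h3, ?_⟩
    by_cases hL : L H.choose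
    · exact Or.inl hL
    · exact Or.inr ⟨h2, hL, by rw [h3, h1]⟩
  · rintro ⟨e, i⟩ h' ⟨h1, h2⟩ h3 h4
    obtain rfl : i = leaf e := h2
    have h5 : h'.1 = e := hleaf e h1 h' h3 h4
    rcases eq_or_eq_oppositeHalf (h := h') (h' := (e, leaf e)) h5 with h | h
    · exact h
    · rw [h] at h4
      exact absurd h4.symm (hloop _)
  · rintro h h' ⟨-, -, h1⟩ ⟨-, -, h2⟩ h3
    rw [h3, h1] at h2
    exact (Option.some_injective _ h2).symm
  · rintro ⟨e, i⟩ ⟨h1, h2, -⟩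
    refine ⟨h1, ?_⟩
    have : i ≠ leaf e := fun h => h2 ⟨h1, h⟩
    simp only [oppositeHalf]
    revert this
    cases i <;> cases leaf e <;> simp
  · rintro ⟨e, i⟩ ⟨h1, h2⟩ ⟨h3, h4⟩
    simp only [oppositeHalf] at h2 h4
    rw [← h2] at h4
    simp at h4

/-- The subdivision of a loopless multigraph with maximum degree at most `2 * k + 1` has a star edge
coloring with `3 * k + 2` colors. -/
theorem exists_isHalfStarColoring_of_degree_le_odd {E V : Type*} [Fintype E] [Fintype V]
    [DecidableEq V] (k : ℕ) (ends : E × Bool → V) (hloop : ∀ h, ends h ≠ ends (oppositeHalf h))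
    (hd : ∀ v, #{h | ends h = v} ≤ 2 * k + 1) :
    ∃ f : E × Bool → (Fin k × Fin 3) ⊕ Bool, IsHalfStarColoring ends f := by
  classical
  -- Below, a detached half-edge has a vertex of degree 1 of its own, which exceeds `2 * k` when `k
  -- = 0`.
  rcases Nat.eq_zero_or_pos k with rfl | hk
  · have huniq : ∀ h h', ends h = ends h' → h = h' := fun h h' H =>
      card_le_one.1 (hd (ends h')) h (by simp [H]) h' (by simp)
    exact ⟨fun h => Sum.inr h.2, ⟨fun h => by simp [oppositeHalf],
      fun h h' H H' => absurd (huniq h h' H) H', fun h h' H H' => absurd (huniq h h' H) H',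
      fun h h₁ _ H H' => absurd (huniq h₁ h H) H'⟩⟩
  obtain ⟨F, L, S, hcov, hLF, hSF, hL, hS, hSL, hLL⟩ := exists_spanning_star_forest ends hloop
  let R : E × Bool → Prop := fun h => L h ∨ S h
  -- Detaching the half-edges that get the new colors keeps both halves of every edge, so the even
  -- case still applies.
  let ends' : E × Bool → V ⊕ (E × Bool) := fun h => if R h then Sum.inr h else Sum.inl (ends h)
  have hR : ∀ h, R h → ends' h = Sum.inr h := fun h H => if_pos H
  have hnR : ∀ h, ¬ R h → ends' h = Sum.inl (ends h) := fun h H => if_neg H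
  have hl' : ∀ h, ends' h ≠ ends' (oppositeHalf h) := by
    intro h heq
    by_cases h1 : R h <;> by_cases h2 : R (oppositeHalf h)
    · rw [hR _ h1, hR _ h2, Sum.inr.injEq] at heq
      exact hloop h (congrArg ends heq)
    · rw [hR _ h1, hnR _ h2] at heq; cases heq
    · rw [hnR _ h1, hR _ h2] at heq; cases heq
    · rw [hnR _ h1, hnR _ h2, Sum.inl.injEq] at heq
      exact hloop h heq
  -- the two kinds of removed half-edges share no vertex
  have hRR : ∀ h h', ends h = ends h' → R h → R h' → h = h' := by
    rintro h h' hv (h1 | h1) (h2 | h2)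
    · exact (hL h h' h1 (hLF _ h2) hv.symm).symm
    · exact (hL h h' h1 (hSF _ h2) hv.symm).symm
    · exact hL h' h h2 (hSF _ h1) hv
    · exact (hS h h' h1 h2 hv.symm).symm
  have hd' : ∀ w, #{h | ends' h = w} ≤ 2 * k := by
    rintro (v | h₀)
    · by_cases hne : ∃ h, ends h = v
      · obtain ⟨h, rfl⟩ := hne
        obtain ⟨h', h1, h2⟩ := hcov h
        have hsub : ({x | ends' x = Sum.inl (ends h)} : Finset (E × Bool)) ⊆
            ({x | ends x = ends h} : Finset (E × Bool)).erase h' := by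
          intro x hx
          simp only [mem_filter, mem_univ, true_and, mem_erase] at hx ⊢
          by_cases hx' : R x
          · rw [hR _ hx'] at hx; cases hx
          · rw [hnR _ hx', Sum.inl.injEq] at hx
            refine ⟨?_, hx⟩
            rintro rfl
            exact hx' h2
        refine (card_le_card hsub).trans ?_
        rw [card_erase_of_mem (by simp [h1])]
        have := hd (ends h)
        omega
      · refine le_trans (le_of_eq ?_) (Nat.zero_le _)
        rw [card_eq_zero, filter_eq_empty_iff]
        intro x _ hx
        by_cases hx' : R x
        · rw [hR _ hx'] at hx; cases hx
        · rw [hnR _ hx', Sum.inl.injEq] at hx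
          exact hne ⟨x, hx⟩
    · refine le_trans (card_le_one.2 ?_) (by omega : 1 ≤ 2 * k)
      have : ∀ x, ends' x = Sum.inr h₀ → x = h₀ := by
        intro x hx
        by_cases hx' : R x
        · rw [hR _ hx'] at hx; exact Sum.inr_injective hx
        · rw [hnR _ hx'] at hx; cases hx
      intro a ha b hb
      simp only [mem_filter, mem_univ, true_and] at ha hb
      rw [this a ha, this b hb]
  obtain ⟨g, hg⟩ := exists_isHalfStarColoring_of_degree_le k ends' hl' hd'
  let f : E × Bool → (Fin k × Fin 3) ⊕ Bool := fun h =>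
    if L h then Sum.inr false else if S h then Sum.inr true else Sum.inl (g h)
  have hSnL : ∀ h, S h → ¬ L h := fun h h1 h2 => hLL h h2 (hSL h h1)
  have fL : ∀ h, L h → f h = Sum.inr false := fun h H => if_pos H
  have fS : ∀ h, S h → f h = Sum.inr true := fun h H => (if_neg (hSnL h H)).trans (if_pos H)
  have fN : ∀ h, ¬ R h → f h = Sum.inl (g h) := fun h H =>
    (if_neg fun h' => H (Or.inl h')).trans (if_neg fun h' => H (Or.inr h'))
  have hfL : ∀ h h', f h = f h' → L h → L h' := by
    intro h h' H H'
    rw [fL h H'] at H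
    by_contra h1
    by_cases h2 : S h'
    · rw [fS h' h2] at H; simp at H
    · rw [fN h' (not_or.2 ⟨h1, h2⟩)] at H; cases H
  have hfS : ∀ h h', f h = f h' → S h → S h' := by
    intro h h' H H'
    rw [fS h H'] at H
    by_contra h1
    by_cases h2 : L h'
    · rw [fL h' h2] at H; simp at H
    · rw [fN h' (not_or.2 ⟨h2, h1⟩)] at H; cases H
  have hfR : ∀ h h', f h = f h' → R h → R h' := fun h h' H => Or.imp (hfL h h' H) (hfS h h' H)
  have hfg : ∀ h h', f h = f h' → ¬ R h → ¬ R h' → g h = g h' := by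
    intro h h' H h1 h2
    rw [fN h h1, fN h' h2] at H
    exact Sum.inl_injective H
  have hne_opp : ∀ h, f h ≠ f (oppositeHalf h) := by
    intro h heq
    by_cases h1 : R h
    · rcases h1 with h1 | h1
      · exact hLL h h1 (hfL _ _ heq h1)
      · exact hSnL _ (hfS _ _ heq h1) (hSL h h1)
    · exact hg.ne_opposite h (hfg _ _ heq h1 fun h2 => h1 (hfR _ _ heq.symm h2))
  -- removed half-edges cannot take part in an alternating path centered at a vertex
  have hvert : ∀ h h', ends h = ends h' → h ≠ h' → f h = f (oppositeHalf h') → ¬ R h := by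
    -- In either case `h` and `h'` both belong to edges of `F`, and one of them sits at a leaf,
    -- where `F` has only one half-edge.
    rintro h h' hv hne heq (h1 | h1)
    · exact hne (hL h h' h1 (hLF (oppositeHalf h') (hfL _ (oppositeHalf h') heq h1)) hv.symm).symm
    · have h2 := hSL _ (hfS _ _ heq h1)
      rw [oppositeHalf_oppositeHalf] at h2
      exact hne (hL h' h h2 (hSF _ h1) hv)
  have hends : ∀ h h', ends h = ends h' → ¬ R h → ¬ R h' → ends' h = ends' h' := by
    intro h h' hv h1 h2
    rw [hnR _ h1, hnR _ h2, hv]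
  refine ⟨f, ⟨hne_opp, fun h h' hv hne heq => ?_, fun h h' hv hne heq heq' => ?_,
    fun h h₁ h₂ hv1 hne1 hv2 hne2 heq1 heq2 => ?_⟩⟩
  · by_cases h1 : R h
    · exact hne (hRR h h' hv h1 (hfR _ _ heq h1))
    · have h2 : ¬ R h' := fun h2 => h1 (hfR _ _ heq.symm h2)
      exact hg.ne_of_ends_eq h h' (hends _ _ hv h1 h2) hne (hfg _ _ heq h1 h2)
  · have h1 : ¬ R h := hvert h h' hv hne heq
    have h2 : ¬ R h' := hvert h' h hv.symm hne.symm heq'.symm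
    exact hg.at_vertex h h' (hends _ _ hv h1 h2) hne
      (hfg _ _ heq h1 fun h3 => h1 (hfR _ _ heq.symm h3))
      (hfg _ _ heq' (fun h3 => h2 (hfR _ _ heq' h3)) h2)
  · have h1 : ¬ R h₁ := hvert h₁ h hv1 hne1 heq1
    have h2 : ¬ R h₂ := hvert h₂ (oppositeHalf h) hv2 hne2 (by simpa using heq2)
    have h3 : ¬ R h := fun h3 => h2 (hfR _ _ heq2.symm h3)
    have h4 : ¬ R (oppositeHalf h) := fun h3 => h1 (hfR _ _ heq1.symm h3)
    exact hg.at_edge h h₁ h₂ (hends _ _ hv1 h1 h3) hne1 (hends _ _ hv2 h2 h4) hne2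
      (hfg _ _ heq1 h1 h4) (hfg _ _ heq2 h2 h3)

/-! ### From bipartite graphs to multigraphs -/

namespace SimpleGraph

/-- Four successive edges, properly colored with two colors, must alternate; this treats paths and
cycles alike. -/
theorem isStarEdgeColoring_of_forall {V C : Type*} {G : SimpleGraph V} (f : G.lineGraph.Coloring C)
    (H : ∀ (a b c d e : V) (hab : G.Adj a b) (hbc : G.Adj b c) (hcd : G.Adj c d) (hde : G.Adj d e),
      a ≠ c → b ≠ d → c ≠ e → f ⟨s(a, b), hab⟩ = f ⟨s(c, d), hcd⟩ →
        f ⟨s(b, c), hbc⟩ ≠ f ⟨s(d, e), hde⟩) : IsStarEdgeColoring f := by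
  have hadj : ∀ (a b c : V) (hab : G.Adj a b) (hbc : G.Adj b c), a ≠ c →
      f ⟨s(a, b), hab⟩ ≠ f ⟨s(b, c), hbc⟩ := by
    intro a b c hab hbc hac
    refine f.valid (lineGraph_adj_iff_exists.2 ⟨?_, b, by simp, by simp⟩)
    intro h
    have := congrArg Subtype.val h
    simp only [Sym2.eq_iff] at this
    rcases this with ⟨rfl, -⟩ | ⟨h, -⟩
    · exact hab.ne rfl
    · exact hac h
  have key : ∀ (u v : V) (p : G.Walk u v), p.length = 4 →
      (∀ i j, i ≤ 4 → j ≤ 4 → i + 2 = j → p.getVert i ≠ p.getVert j) →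
      (p.colorSet f).encard ≠ 2 := by
    intro u v p hlen hne
    match p, hlen with
    | .cons (v := b) h1 (.cons (v := c) h2 (.cons (v := d) h3 (.cons (v := e) h4 .nil))), _ =>
      have n1 := hne 0 2 (by norm_num) (by norm_num) rfl
      have n2 := hne 1 3 (by norm_num) (by norm_num) rfl
      have n3 := hne 2 4 (by norm_num) (by norm_num) rfl
      simp only [Walk.getVert_cons_succ, Walk.getVert_zero] at n1 n2 n3
      intro hcard
      obtain ⟨x, y, hxy, hset⟩ := Set.encard_eq_two.1 hcard
      have hmem : ∀ (a b : V) (hab : G.Adj a b), s(a, b) ∈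
          (Walk.cons h1 (.cons h2 (.cons h3 (.cons h4 .nil)))).edges →
          f ⟨s(a, b), hab⟩ = x ∨ f ⟨s(a, b), hab⟩ = y := by
        intro a b hab hm
        have : f ⟨s(a, b), hab⟩ ∈ ({x, y} : Set C) := by
          rw [← hset]
          exact ⟨_, hm, rfl⟩
        simpa using this
      have m1 := hmem _ _ h1 (by simp)
      have m2 := hmem _ _ h2 (by simp)
      have m3 := hmem _ _ h3 (by simp)
      have m4 := hmem _ _ h4 (by simp)
      have a1 := hadj _ _ _ h1 h2 n1
      have a2 := hadj _ _ _ h2 h3 n2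
      have a3 := hadj _ _ _ h3 h4 n3
      have := H _ _ _ _ _ h1 h2 h3 h4 n1 n2 n3
      grind
  refine ⟨fun u v p hp hlen => key u v p hlen ?_, fun u p hp hlen => key u u p hlen ?_⟩
  · intro i j hi hj hij h
    have := hp.getVert_injOn (by simpa [hlen] using hi) (by simpa [hlen] using hj) h
    omega
  · intro i j hi hj hij h
    -- On a cycle positions 0 and 4 coincide, so injectivity holds on 0 to 3 and on 1 to 4
    -- separately.
    rcases Nat.eq_zero_or_pos i with rfl | hi0
    · have := hp.getVert_injOn' (by simp [hlen]) (by simp [hlen]; omega) h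
      omega
    · have := hp.getVert_injOn (by simp [hlen]; omega) (by simp [hlen]; omega) h
      omega

theorem starEdgeColorable_of_maxDegreeOn {V : Type*} [Finite V] {G : SimpleGraph V} {X Y : Set V}
    (k : ℕ) (hG : G.HasBipartition X Y) (hX : G.maxDegreeOn X ≤ 2)
    (hY : G.maxDegreeOn Y ≤ ((2 * k + 1 : ℕ) : ℕ∞)) : G.StarEdgeColorable (3 * k + 2) := by
  classical
  have := Fintype.ofFinite V
  have hXd : ∀ x ∈ X, (G.neighborSet x).encard ≤ 2 := fun x hx =>
    (le_iSup₂ (f := fun v (_ : v ∈ X) => (G.neighborSet v).encard) x hx).trans hX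
  have hYd : ∀ y ∈ Y, (G.neighborSet y).encard ≤ ((2 * k + 1 : ℕ) : ℕ∞) := fun y hy =>
    (le_iSup₂ (f := fun v (_ : v ∈ Y) => (G.neighborSet v).encard) y hy).trans hY
  have hdisj : ∀ v, v ∈ X → v ∈ Y → False := fun v h h' => Set.disjoint_left.1 hG.1.disjoint h h'
  have hXY : ∀ x y, x ∈ X → G.Adj x y → y ∈ Y := fun x y hx h => hG.1.mem_of_mem_adj hx h
  have hYX : ∀ x y, y ∈ Y → G.Adj x y → x ∈ X := fun x y hy h => hG.1.mem_of_mem_adj' hy h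
  let E := {x : V // x ∈ X ∧ ∃ y, G.Adj x y}
  -- For a vertex `x` of degree 1, the missing second end is `x` itself, serving as a dummy vertex
  -- of degree 1.
  have hex : ∀ e : E, ∃ g : Bool → V, (∀ y, G.Adj e.1 y → ∃ i, g i = y) ∧ g false ≠ g true ∧
      G.Adj e.1 (g false) ∧ (G.Adj e.1 (g true) ∨ g true = e.1) := by
    rintro ⟨x, hx, y, hy⟩
    by_cases h : ∃ z, G.Adj x z ∧ z ≠ y
    · obtain ⟨z, hz, hzy⟩ := h
      refine ⟨fun i => bif i then z else y, fun w hw => ?_, hzy.symm, hy, Or.inl hz⟩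
      by_contra hcon
      have h1 : ({y, z, w} : Set V) ⊆ G.neighborSet x := by
        rintro _ (rfl | rfl | rfl) <;> assumption
      have h2 : ({y, z, w} : Set V).encard = 3 := by
        refine Set.encard_eq_three.2 ⟨y, z, w, hzy.symm, fun h => hcon ⟨false, h⟩,
          fun h => hcon ⟨true, h⟩, rfl⟩
      have h3 := (Set.encard_le_encard h1).trans (hXd x hx)
      rw [h2] at h3
      exact absurd h3 (by norm_num)
    · push Not at h
      refine ⟨fun i => bif i then x else y, fun w hw => ⟨false, (h w hw).symm⟩, hy.ne', hy,
        Or.inr rfl⟩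
  choose g hg1 hg2 hg3 hg4 using hex
  let ends : E × Bool → V := fun h => g h.1 h.2
  have hloop : ∀ h, ends h ≠ ends (oppositeHalf h) := by
    rintro ⟨e, i⟩
    cases i
    · exact hg2 e
    · exact (hg2 e).symm
  have hadj : ∀ h, G.Adj h.1.1 (ends h) ∨ ends h = h.1.1 := by
    rintro ⟨e, i⟩
    cases i
    · exact Or.inl (hg3 e)
    · exact hg4 e
  have hd : ∀ v, #{h | ends h = v} ≤ 2 * k + 1 := by
    intro v
    by_cases hv : v ∈ Y
    · have h1 : #{h | ends h = v} ≤ #(G.neighborSet v).toFinset := by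
        have hA : ∀ h : E × Bool, ends h = v → G.Adj h.1.1 v := by
          intro h hh
          rcases hadj h with h' | h'
          · rwa [hh] at h'
          · rw [hh] at h'
            exact (hdisj v (h' ▸ h.1.2.1) hv).elim
        refine card_le_card_of_injOn (fun h => h.1.1) (fun h hh => ?_) (fun h hh h' hh' heq => ?_)
        · simpa using (hA h (by simpa using hh)).symm
        · simp only [coe_filter, mem_univ, true_and, Set.mem_ofPred_eq] at hh hh'
          rcases eq_or_eq_oppositeHalf (Subtype.ext heq : h.1 = h'.1) with H | H
          · exact H
          · rw [H] at hh
            exact absurd (hh'.trans hh.symm) (hloop h')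
      have h2 := hYd v hv
      rw [Set.encard_eq_coe_toFinset_card] at h2
      exact h1.trans (by exact_mod_cast h2)
    · refine le_trans (card_le_one.2 ?_) (by omega : 1 ≤ 2 * k + 1)
      have hA : ∀ h : E × Bool, ends h = v → h.1.1 = v ∧ h.2 = true := by
        rintro ⟨e, i⟩ rfl
        rcases hadj (e, i) with h' | h'
        · exact absurd (hXY _ _ e.2.1 h') hv
        · refine ⟨h'.symm, ?_⟩
          cases i
          · exact absurd (hXY _ _ e.2.1 (hg3 e)) hv
          · rfl
      intro a ha b hb
      simp only [mem_filter, mem_univ, true_and] at ha hb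
      exact Prod.ext (Subtype.ext ((hA a ha).1.trans (hA b hb).1.symm))
        ((hA a ha).2.trans (hA b hb).2.symm)
  obtain ⟨φ, hφ⟩ := exists_isHalfStarColoring_of_degree_le_odd k ends hloop hd
  have hhalf : ∀ x y, x ∈ X → G.Adj x y → ∃ h : E × Bool, h.1.1 = x ∧ ends h = y := by
    intro x y hx hxy
    obtain ⟨i, hi⟩ := hg1 ⟨x, hx, y, hxy⟩ y hxy
    exact ⟨(⟨x, hx, y, hxy⟩, i), rfl, hi⟩
  -- The condition `ends h ∈ Y` rules out dummy half-edges.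
  have hedge : ∀ e : G.edgeSet, ∃ h : E × Bool, e.1 = s(h.1.1, ends h) ∧ ends h ∈ Y := by
    rintro ⟨e, he⟩
    induction e using Sym2.ind with
    | _ a b =>
      have hab : G.Adj a b := he
      rcases (hG.2.symm ▸ Set.mem_univ a : a ∈ X ∪ Y) with ha | ha
      · obtain ⟨h, rfl, rfl⟩ := hhalf a b ha hab
        exact ⟨h, rfl, hXY _ _ ha hab⟩
      · obtain ⟨h, rfl, rfl⟩ := hhalf b a (hYX _ _ ha hab.symm) hab.symm
        exact ⟨h, Sym2.eq_swap, ha⟩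
  choose half hhalf1 hhalf2 using hedge
  have hhalf3 : ∀ (x y : V) (hxy : G.Adj x y), x ∈ X →
      (half ⟨s(x, y), hxy⟩).1.1 = x ∧ ends (half ⟨s(x, y), hxy⟩) = y := by
    intro x y hxy hx
    have h1 := hhalf1 ⟨s(x, y), hxy⟩
    have h2 := hhalf2 ⟨s(x, y), hxy⟩
    rw [Sym2.eq_iff] at h1
    rcases h1 with h | h
    · exact ⟨h.1.symm, h.2.symm⟩
    · exact (hdisj x hx (by rw [h.1]; exact h2)).elim
  have hhalf3' : ∀ (x y : V) (hyx : G.Adj y x), x ∈ X →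
      (half ⟨s(y, x), hyx⟩).1.1 = x ∧ ends (half ⟨s(y, x), hyx⟩) = y := by
    intro x y hyx hx
    have : (⟨s(y, x), hyx⟩ : G.edgeSet) = ⟨s(x, y), hyx.symm⟩ := Subtype.ext Sym2.eq_swap
    rw [this]
    exact hhalf3 x y hyx.symm hx
  have hinj : ∀ e e', half e = half e' → e = e' := by
    intro e e' h
    apply Subtype.ext
    rw [hhalf1 e, hhalf1 e', h]
  have hopp : ∀ e e', (half e).1.1 = (half e').1.1 → e ≠ e' →
      half e = oppositeHalf (half e') := by
    intro e e' h hne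
    exact (eq_or_eq_oppositeHalf (Subtype.ext h)).resolve_left fun h => hne (hinj _ _ h)
  have hproper : ∀ e e', e ≠ e' → (∃ v, v ∈ e.1 ∧ v ∈ e'.1) → φ (half e) ≠ φ (half e') := by
    rintro e e' hne ⟨v, hv, hv'⟩
    rw [hhalf1, Sym2.mem_iff] at hv hv'
    rcases hv with hv | hv <;> rcases hv' with hv' | hv'
    · rw [hopp e e' (hv.symm.trans hv') hne]
      exact (hφ.ne_opposite _).symm
    · exact (hdisj v (hv ▸ (half e).1.2.1) (hv' ▸ hhalf2 e')).elim
    · exact (hdisj v (hv' ▸ (half e').1.2.1) (hv ▸ hhalf2 e)).elim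
    · exact hφ.ne_of_ends_eq _ _ (hv.symm.trans hv') fun h => hne (hinj _ _ h)
  have hne_edge : ∀ (a b c : V) (hab : G.Adj a b) (hbc : G.Adj b c), a ≠ c →
      (⟨s(a, b), hab⟩ : G.edgeSet) ≠ ⟨s(b, c), hbc⟩ := by
    intro a b c hab hbc hac h
    have := congrArg Subtype.val h
    simp only [Sym2.eq_iff] at this
    rcases this with ⟨rfl, -⟩ | ⟨h, -⟩
    · exact hab.ne rfl
    · exact hac h
  let ψ : (Fin k × Fin 3) ⊕ Bool ≃ Fin (3 * k + 2) := Fintype.equivFinOfCardEq (by simp; ring)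
  let f : G.lineGraph.Coloring (Fin (3 * k + 2)) := Coloring.mk (fun e => ψ (φ (half e))) (by
    intro e e' h
    rw [lineGraph_adj_iff_exists] at h
    exact fun H => hproper e e' h.1 h.2 (ψ.injective H))
  refine ⟨f, isStarEdgeColoring_of_forall f ?_⟩
  intro a b c d e hab hbc hcd hde hac hbd hce h1 h2
  replace h1 := ψ.injective h1
  replace h2 := ψ.injective h2
  -- The middle vertex `c` is either a subdividing vertex, handled by `at_edge`, or a multigraph
  -- vertex, handled by `at_vertex`.
  rcases (hG.2.symm ▸ Set.mem_univ c : c ∈ X ∪ Y) with hc | hc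
  · have hb := hXY _ _ hc hbc.symm
    have hd := hXY _ _ hc hcd
    have ha := hYX _ _ hb hab
    have he := hYX _ _ hd hde.symm
    have k1 := hhalf3 a b hab ha
    have k2 := hhalf3' c b hbc hc
    have k3 := hhalf3 c d hcd hc
    have k4 := hhalf3' e d hde he
    have ho := hopp _ _ (k3.1.trans k2.1.symm) (hne_edge b c d hbc hcd hbd).symm
    refine hφ.at_edge (half ⟨s(b, c), hbc⟩) (half ⟨s(a, b), hab⟩) (half ⟨s(d, e), hde⟩)
      (k1.2.trans k2.2.symm) (fun h => hne_edge a b c hab hbc hac (hinj _ _ h)) ?_ ?_ ?_ h2.symm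
    · rw [← ho, k4.2, k3.2]
    · rw [← ho]
      exact fun h => hne_edge c d e hcd hde hce (hinj _ _ h).symm
    · rw [← ho, h1]
  · have hb := hYX _ _ hc hbc
    have hd := hYX _ _ hc hcd.symm
    have k1 := hhalf3' b a hab hb
    have k2 := hhalf3 b c hbc hb
    have k3 := hhalf3' d c hcd hd
    have k4 := hhalf3 d e hde hd
    have ho1 := hopp _ _ (k1.1.trans k2.1.symm) (hne_edge a b c hab hbc hac)
    have ho2 := hopp _ _ (k4.1.trans k3.1.symm) (hne_edge c d e hcd hde hce).symm
    refine hφ.at_vertex (half ⟨s(b, c), hbc⟩) (half ⟨s(c, d), hcd⟩) (k2.2.trans k3.2.symm)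
      (fun h => hne_edge b c d hbc hcd hbd (hinj _ _ h)) ?_ ?_
    · rw [← ho2, h2]
    · rw [← ho1, h1]

end SimpleGraph

/-! ### Sharpness -/

namespace SimpleGraph

/-- The ends `a` and `e` may coincide: the walk is then a 4-cycle, otherwise a path, and both are
forbidden. -/
theorem IsStarEdgeColoring.ne_of_alternating {V C : Type*} {G : SimpleGraph V}
    {f : G.lineGraph.Coloring C} (hf : IsStarEdgeColoring f) {a b c d e : V} (hab : G.Adj a b)
    (hbc : G.Adj b c) (hcd : G.Adj c d) (hde : G.Adj d e) (hac : a ≠ c) (had : a ≠ d)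
    (hbd : b ≠ d) (hbe : b ≠ e) (hce : c ≠ e) (h : f ⟨s(a, b), hab⟩ = f ⟨s(c, d), hcd⟩) :
    f ⟨s(b, c), hbc⟩ ≠ f ⟨s(d, e), hde⟩ := by
  intro h'
  have hne : f ⟨s(a, b), hab⟩ ≠ f ⟨s(b, c), hbc⟩ := by
    refine f.valid (lineGraph_adj_iff_exists.2 ⟨fun H => ?_, b, by simp, by simp⟩)
    have := congrArg Subtype.val H
    simp only [Sym2.eq_iff] at this
    rcases this with ⟨rfl, -⟩ | ⟨H, -⟩
    · exact hab.ne rfl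
    · exact hac H
  let p : G.Walk a e := .cons hab (.cons hbc (.cons hcd (.cons hde .nil)))
  have hcol : (p.colorSet f).encard = 2 := by
    have : p.colorSet f = {f ⟨s(a, b), hab⟩, f ⟨s(b, c), hbc⟩} := by
      ext x
      constructor
      · rintro ⟨⟨z, hz⟩, hzp, rfl⟩
        have hzp' : z ∈ p.edges := hzp
        simp only [p, Walk.edges_cons, Walk.edges_nil, List.mem_cons, List.not_mem_nil,
          or_false] at hzp'
        rcases hzp' with rfl | rfl | rfl | rfl
        · exact Or.inl rfl
        · exact Or.inr rfl
        · exact Or.inl h.symm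
        · exact Or.inr h'.symm
      · rintro (rfl | rfl)
        · exact ⟨⟨s(a, b), hab⟩, show s(a, b) ∈ p.edges by simp [p], rfl⟩
        · exact ⟨⟨s(b, c), hbc⟩, show s(b, c) ∈ p.edges by simp [p], rfl⟩
    rw [this, Set.encard_pair hne]
  by_cases hae : a = e
  · subst hae
    refine hf.2 a p ?_ rfl hcol
    simp only [p, Walk.cons_isCycle_iff, Walk.cons_isPath_iff, Walk.support_cons,
      Walk.support_nil, Walk.edges_cons, Walk.edges_nil]
    simp [hab.ne, hbc.ne, hcd.ne, hde.ne, hab.ne', hac, hac.symm, hbd, had]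
  · refine hf.1 a e p ?_ rfl hcol
    simp [p, Walk.cons_isPath_iff, hab.ne, hbc.ne, hcd.ne, hde.ne, hac, had, hae, hbd, hbe, hce]

theorem le_of_starEdgeColorable_completeBipartiteGraph {k n : ℕ}
    (h : (completeBipartiteGraph (Fin (2 * k + 1)) Bool).StarEdgeColorable n) : 3 * k + 2 ≤ n := by
  obtain ⟨f, hf⟩ := h
  have hadj : ∀ (i : Fin (2 * k + 1)) (y : Bool),
      (completeBipartiteGraph (Fin (2 * k + 1)) Bool).Adj (.inl i) (.inr y) := by simp
  let c : Bool → Fin (2 * k + 1) → Fin n := fun y i => f ⟨s(.inl i, .inr y), hadj i y⟩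
  have hswap : ∀ i y, f ⟨s(.inr y, .inl i), (hadj i y).symm⟩ = c y i := fun i y =>
    congrArg f (Subtype.ext Sym2.eq_swap)
  have hinj : ∀ y, Function.Injective (c y) := by
    intro y i j hij
    by_contra hne
    refine f.valid (lineGraph_adj_iff_exists.2 ⟨fun H => hne ?_, .inr y, ?_, ?_⟩) hij
    · simpa using congrArg Subtype.val H
    · simp
    · simp
  have hne : ∀ i, c false i ≠ c true i := by
    intro i
    refine f.valid (lineGraph_adj_iff_exists.2 ⟨fun H => ?_, .inl i, ?_, ?_⟩)
    · simpa using congrArg Subtype.val H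
    · simp
    · simp
  -- Otherwise the walk `i₁`, `false`, `i₂`, `true`, `i₃` alternates between two colors.
  have hno : ∀ i₁ i₂ i₃, c false i₁ = c true i₂ → c false i₂ ≠ c true i₃ := by
    intro i₁ i₂ i₃ h1 h2
    have h12 : i₁ ≠ i₂ := by rintro rfl; exact hne _ h1
    have h23 : i₂ ≠ i₃ := by rintro rfl; exact hne _ h2
    refine hf.ne_of_alternating (hadj i₁ false) (hadj i₂ false).symm (hadj i₂ true)
      (hadj i₃ true).symm ?_ ?_ ?_ ?_ ?_ h1 ?_
    · simpa using h12
    · simp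
    · simp
    · simp
    · simpa using h23
    · rw [hswap, hswap, h2]
  let P : Bool → Finset (Fin n) := fun y => univ.image (c y)
  have hP : ∀ y, #(P y) = 2 * k + 1 := fun y => by
    simp [P, card_image_of_injective _ (hinj y)]
  -- Both sets have as many elements as the two palettes have common colors. By `hno` they are
  -- disjoint, so at most `k` colors are common and at least `2(2k+1) - k` are used.
  let A : Bool → Finset (Fin (2 * k + 1)) := fun y => {i | c y i ∈ P !y}
  have hA : ∀ y, #(A y) = #(P y ∩ P !y) := by
    intro y
    rw [← card_image_of_injective _ (hinj y)]
    congr 1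
    ext x
    simp only [A, P, mem_image, mem_filter, mem_univ, true_and, mem_inter]
    constructor
    · rintro ⟨i, ⟨j, hj⟩, rfl⟩; exact ⟨⟨i, rfl⟩, j, hj⟩
    · rintro ⟨⟨i, rfl⟩, j, hj⟩; exact ⟨i, ⟨j, hj⟩, rfl⟩
  have hdisj : Disjoint (A false) (A true) := by
    rw [Finset.disjoint_left]
    intro i h1 h2
    simp only [A, P, mem_filter, mem_univ, true_and, mem_image, Bool.not_false,
      Bool.not_true] at h1 h2
    obtain ⟨j, hj⟩ := h1
    obtain ⟨l, hl⟩ := h2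
    exact hno l i j hl hj.symm
  have h1 : #(A false) + #(A true) ≤ 2 * k + 1 := by
    rw [← card_union_of_disjoint hdisj]
    simpa using card_le_univ (A false ∪ A true)
  have h2 := hA false
  have h3 := hA true
  have h4 := card_union_add_card_inter (P false) (P true)
  have h5 : #(P false ∪ P true) ≤ n := by simpa using card_le_univ (P false ∪ P true)
  have h6 := hP false
  have h7 := hP true
  simp only [Bool.not_false, Bool.not_true] at h2 h3
  rw [inter_comm] at h3
  omega

theorem completeBipartiteGraph_hasBipartition (α β : Type*) :
    (completeBipartiteGraph α β).HasBipartition (Set.range Sum.inl) (Set.range Sum.inr) := by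
  refine ⟨⟨Set.isCompl_range_inl_range_inr.disjoint, ?_⟩, Set.range_inl_union_range_inr⟩
  rintro (a | a) (b | b) h <;> simp_all

theorem maxDegreeOn_completeBipartiteGraph_left (α β : Type*) [Nonempty α] :
    (completeBipartiteGraph α β).maxDegreeOn (Set.range Sum.inl) = ENat.card β := by
  have h : ∀ a : α, ((completeBipartiteGraph α β).neighborSet (.inl a)).encard = ENat.card β := by
    intro a
    have : (completeBipartiteGraph α β).neighborSet (.inl a) = Set.range Sum.inr := by
      ext (x | x) <;> simp
    rw [this, ← Set.image_univ, Sum.inr_injective.encard_image, Set.encard_univ]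
  rw [maxDegreeOn, iSup_range]
  simp [h]

theorem maxDegreeOn_completeBipartiteGraph_right (α β : Type*) [Nonempty β] :
    (completeBipartiteGraph α β).maxDegreeOn (Set.range Sum.inr) = ENat.card α := by
  have h : ∀ b : β, ((completeBipartiteGraph α β).neighborSet (.inr b)).encard = ENat.card α := by
    intro b
    have : (completeBipartiteGraph α β).neighborSet (.inr b) = Set.range Sum.inl := by
      ext (x | x) <;> simp
    rw [this, ← Set.image_univ, Sum.inl_injective.encard_image, Set.encard_univ]
  rw [maxDegreeOn, iSup_range]
  simp [h]

/-! ### The star chromatic index -/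

theorem starChromaticIndex_le_of_maxDegreeOn {V : Type*} [Finite V] {G : SimpleGraph V}
    {X Y : Set V} (k : ℕ) (hG : G.HasBipartition X Y) (hX : G.maxDegreeOn X ≤ 2)
    (hY : G.maxDegreeOn Y ≤ ((2 * k + 1 : ℕ) : ℕ∞)) :
    G.starChromaticIndex ≤ ((3 * k + 2 : ℕ) : ℕ∞) :=
  iInf₂_le (f := fun (n : ℕ) (_ : n ∈ {n : ℕ | G.StarEdgeColorable n}) => (n : ℕ∞)) (3 * k + 2)
    (starEdgeColorable_of_maxDegreeOn k hG hX hY)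

end SimpleGraph

theorem mainTheorem1 (k : ℕ) :
    (∀ (V : Type*) [Finite V] (G : SimpleGraph V) (X Y : Set V),
      G.HasBipartition X Y → G.maxDegreeOn X = 2 → G.maxDegreeOn Y = ((2 * k + 1 : ℕ) : ℕ∞) →
        G.starChromaticIndex ≤ ((3 * k + 2 : ℕ) : ℕ∞)) ∧
    (∃ (V : Type) (_ : Finite V) (G : SimpleGraph V) (X Y : Set V),
      G.HasBipartition X Y ∧ G.maxDegreeOn X = 2 ∧ G.maxDegreeOn Y = ((2 * k + 1 : ℕ) : ℕ∞) ∧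
        G.starChromaticIndex = ((3 * k + 2 : ℕ) : ℕ∞)) := by
  refine ⟨fun V _ G X Y hG hX hY =>
    SimpleGraph.starChromaticIndex_le_of_maxDegreeOn k hG hX.le hY.le, ?_⟩
  have hX := SimpleGraph.maxDegreeOn_completeBipartiteGraph_left (Fin (2 * k + 1)) Bool
  have hY := SimpleGraph.maxDegreeOn_completeBipartiteGraph_right (Fin (2 * k + 1)) Bool
  rw [ENat.card_eq_coe_fintype_card, Fintype.card_bool, Nat.cast_ofNat] at hX
  rw [ENat.card_eq_coe_fintype_card, Fintype.card_fin] at hY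
  have hG := SimpleGraph.completeBipartiteGraph_hasBipartition (Fin (2 * k + 1)) Bool
  refine ⟨Fin (2 * k + 1) ⊕ Bool, inferInstance, completeBipartiteGraph _ _, _, _, hG, hX, hY,
    le_antisymm (SimpleGraph.starChromaticIndex_le_of_maxDegreeOn k hG hX.le hY.le) ?_⟩
  refine le_iInf₂ fun n hn => ?_
  exact_mod_cast SimpleGraph.le_of_starEdgeColorable_completeBipartiteGraph hn
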